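/- **Model.** Let $N\ge 2$ and let $T$ (horizon) and $B$ (battery capacity) be nonnegative integers. For $i\in\{1,\dots,N\}$ and $t\ge 1$ let $X^i_t$ be a random vector in $\mathbb R^{n_i}$ with probability density $\pi_i$, and let $Z_t$ be $\mathbb Z_{\ge0}$-valued with a probability mass function $p_Z$; all the variables $X^i_t$, $Z_t$ are mutually independent. Assume that $\pi_i$ is symmetric and unimodal around $a^i\in\mathbb R^{n_i}$, i.e. $\|x-a^i\|\le\|y-a^i\|$ implies $\pi_i(x)\ge\pi_i(y)$. With $\mathbf X_t=(X^1_t,\dots,X^N_t)$, at each time $t\in\{1,\dots,T\}$ a scheduler chooses $$U_t=f_t(\mathbf X_{1:t},E_{1:t},\mathbf Y_{1:t-1})\in\{0,1,\dots,N\},\qquad U_t=0 \text{ whenever } E_t=0,$$ where $U_t=i\ne0$ means that $X^i_t$ is transmitted and $U_t=0$ that nothing is. The battery level satisfies $E_1=B$ and $E_{t+1}=\min\{E_t-\mathbb I(U_t\ne0)+Z_t,\,B\}$. Estimator $i$ receives $Y^i_t=X^i_t$ if $U_t=i$ and $Y^i_t=\varnothing$ otherwise, $\mathbf Y_t=(Y^1_t,\dots,Y^N_t)$,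 and it outputs $\hat X^i_t=g^i_t(Y^i_{1:t})$. All $f_t,g^i_t$ are measurable. For weights $w_i>0$ and communication costs $c_i\ge0$ the cost of a strategy profile, with values in $[0,\infty]$, is $$\mathcal J(\mathbf f,\mathbf g^1,\dots,\mathbf g^N)=\sum_{t=1}^T\mathbb E\Big[\sum_{i=1}^N \big(w_i\|X^i_t-\hat X^i_t\|^2+c_i\,\mathbb I(U_t=i)\big)\Big].$$ A profile is globally optimal if it minimizes $\mathcal J$ jointly over all such strategies $(\mathbf f,\mathbf g^1,\dots,\mathbf g^N)$. Let $g^{i\star}_t(Y^i_{1:t})=Y^i_t$ if $Y^i_t\neq\varnothing$ and $g^{i\star}_t(Y^i_{1:t})=a^i$ if $Y^i_t=\varnothing$. **Claim.** 1. (Uniform case.) Let $w_i=1$ and $c_i=c\ge0$ for all $i$. There are thresholds $\tau^\star_t(e)\in[0,\infty)$, depending only on the time $t$ and the energy level $e$ (and on the data of the problem), such that $(\mathbf f^\star,\mathbf g^{1\star},\dots,\mathbf g^{N\star})$ is globally optimal, where $U_t=f^\star_t(\mathbf X_t,E_t)$ with $f^\star_t(\mathbf x,0)=0$ and, for $e>0$,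 $$f^\star_t(\mathbf x,e)=\begin{cases}0,&\max_i\|x^i-a^i\|\le\tau^\star_t(e),\\ \arg\max_i\|x^i-a^i\|,&\text{otherwise,}\end{cases}$$ where $\arg\max$ is the smallest maximizing index. 2. (Unequal weights and costs.) Let $w_i>0$ and $c_i\ge0$ be arbitrary. There are $\tau^i_t(e)\in[0,\infty)$, depending only on $i$, $t$, $e$ (and on the data of the problem), such that $(\mathbf f^\star,\mathbf g^{1\star},\dots,\mathbf g^{N\star})$, with the same estimators, is globally optimal, where $U_t=f^\star_t(\mathbf X_t,E_t)$ with $f^\star_t(\mathbf x,0)=0$ and, for $e>0$, $f^\star_t(\mathbf x,e)=0$ if $\|x^i-a^i\|\le\sqrt{\tau^i_t(e)/w_i}$ for all $i$, and otherwise $f^\star_t(\mathbf x,e)$ is the smallest $i$ such that $$\|x^i-a^i\|>\sqrt{\tau^i_t(e)/w_i}\quad\text{and}\quad w_i\|x^i-a^i\|^2-w_j\|x^j-a^j\|^2\ge\tau^i_t(e)-\tau^j_t(e)\ \text{ for all } j.$$ In particular, for $N=2$ and $e>0$, $$f^\star_t(\mathbf x,e)=\begin{cases}0,&\|x^1-a^1\|\le\sqrt{\tau^1_t(e)/w_1},\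 \|x^2-a^2\|\le\sqrt{\tau^2_t(e)/w_2},\\ 1,&\|x^1-a^1\|>\sqrt{\tau^1_t(e)/w_1},\ w_1\|x^1-a^1\|^2-w_2\|x^2-a^2\|^2\ge\tau^1_t(e)-\tau^2_t(e),\\ 2,&\text{otherwise.}\end{cases}$$ -/

import Mathlib

open MeasureTheory ProbabilityTheory
open scoped ENNReal

noncomputable section

namespace RemoteScheduling

/-- The disjoint-union sigma-algebra on `Option α`: a set is measurable iff its trace on `α` is.
On `Option (Fin N)` this is the discrete sigma-algebra. -/
instance instMeasurableSpaceOption {α : Type*} [m : MeasurableSpace α] :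
    MeasurableSpace (Option α) :=
  MeasurableSpace.map some m

/-- The vectors `x = (x¹, …, xᴺ)` of simultaneous sensor observations, `xⁱ ∈ ℝ^(n i)`. -/
abbrev Obs {N : ℕ} (n : Fin N → ℕ) : Type :=
  (i : Fin N) → EuclideanSpace ℝ (Fin (n i))

/-- The vectors `y = (y¹, …, yᴺ)` of packets; `yⁱ = none` is the symbol `∅` (nothing received). -/
abbrev Packets {N : ℕ} (n : Fin N → ℕ) : Type :=
  (i : Fin N) → Option (EuclideanSpace ℝ (Fin (n i)))

/-- Scheduling decisions: `none` is "no transmission" and `some i` is "transmit `xⁱ`". -/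
abbrev Decision (N : ℕ) : Type := Option (Fin N)

/-- A scheduling strategy: at each time `t = 0, 1, …` a decision
`U_t = f_t (X_{0:t}, E_{0:t}, Y_{0:t-1})`. -/
abbrev Scheduler {N : ℕ} (n : Fin N → ℕ) : Type :=
  (t : ℕ) → (Fin (t + 1) → Obs n) → (Fin (t + 1) → ℕ) → (Fin t → Packets n) → Decision N

/-- An estimation strategy for a sensor in `ℝᵈ`: at each time `t` an estimate `g_t (Y_{0:t})` that
is a function of the packets received by that estimator only. -/
abbrev Estimator (d : ℕ) : Type :=
  (t : ℕ) → (Fin (t + 1) → Option (EuclideanSpace ℝ (Fin d))) → EuclideanSpace ℝ (Fin d)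

/-- A scheduling strategy is admissible if every `f_t` is measurable and nothing is transmitted
when the battery is empty. -/
structure Scheduler.Admissible {N : ℕ} {n : Fin N → ℕ} (f : Scheduler n) : Prop where
  measurable : ∀ t, Measurable
    (fun h : (Fin (t + 1) → Obs n) × (Fin (t + 1) → ℕ) × (Fin t → Packets n) =>
      f t h.1 h.2.1 h.2.2)
  feasible : ∀ t x e y, e (Fin.last t) = 0 → f t x e y = none

/-- An estimation strategy is admissible if every `g_t` is measurable. -/
def Estimator.Admissible {d : ℕ} (g : Estimator d) : Prop :=
  ∀ t, Measurable (g t)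

/-- Battery dynamics `min {e - 𝕀(u ≠ 0) + z, B}` with capacity `B`. (The truncated subtraction is
never used at `e = 0` by an admissible scheduler.) -/
def nextEnergy {N : ℕ} (B e : ℕ) (u : Decision N) (z : ℕ) : ℕ :=
  min (e - (if u = none then 0 else 1) + z) B

/-- The unicast network: only the estimator of the scheduled sensor receives its packet. -/
def received {N : ℕ} {n : Fin N → ℕ} (x : Obs n) (u : Decision N) : Packets n :=
  fun i => if u = some i then some (x i) else none

/-- Along realizations `x` of the sources and `z` of the harvested energy, the pair
`(E_{0:t}, Y_{0:t-1})` of histories when the scheduling strategy `f` is used, with `E_0 = B`. -/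
def history {N : ℕ} {n : Fin N → ℕ} (B : ℕ) (f : Scheduler n) (x : ℕ → Obs n) (z : ℕ → ℕ) :
    (t : ℕ) → (Fin (t + 1) → ℕ) × (Fin t → Packets n)
  | 0 => (fun _ => B, Fin.elim0)
  | t + 1 =>
    let h := history B f x z t
    let u := f t (fun s => x s) h.1 h.2
    (Fin.snoc (α := fun _ => ℕ) h.1 (nextEnergy B (h.1 (Fin.last t)) u (z t)),
      Fin.snoc (α := fun _ => Packets n) h.2 (received (x t) u))

/-- The decision `U_t` along a realization. -/
def decision {N : ℕ} {n : Fin N → ℕ} (B : ℕ) (f : Scheduler n) (x : ℕ → Obs n) (z : ℕ → ℕ)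
    (t : ℕ) : Decision N :=
  f t (fun s => x s) (history B f x z t).1 (history B f x z t).2

/-- The estimate of sensor `i` at time `t` along a realization. -/
def estimate {N : ℕ} {n : Fin N → ℕ} (B : ℕ) (f : Scheduler n) (x : ℕ → Obs n) (z : ℕ → ℕ)
    (i : Fin N) (g : Estimator (n i)) (t : ℕ) : EuclideanSpace ℝ (Fin (n i)) :=
  g t (fun s => received (x s) (decision B f x z s) i)

/-- The cost `∑_{t < T} 𝔼[∑ᵢ wᵢ ‖Xⁱ_t - X̂ⁱ_t‖² + cᵢ 𝕀(U_t = i)]`, with values in `[0, ∞]`.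
With `wᵢ = 1` and `cᵢ = c` for all `i` it is
`∑_{t < T} 𝔼[∑ᵢ ‖Xⁱ_t - X̂ⁱ_t‖² + c 𝕀(U_t ≠ 0)]`. -/
def cost {N : ℕ} {n : Fin N → ℕ} {Ω : Type*} [MeasurableSpace Ω] (P : Measure Ω)
    (X : ℕ → Ω → Obs n) (Z : ℕ → Ω → ℕ) (B T : ℕ) (w c : Fin N → ℝ)
    (f : Scheduler n) (g : (i : Fin N) → Estimator (n i)) : ℝ≥0∞ :=
  ∑ t ∈ Finset.range T, ∫⁻ ω, ∑ i : Fin N,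
    (ENNReal.ofReal (w i * ‖X t ω i -
        estimate B f (fun s => X s ω) (fun s => Z s ω) i (g i) t‖ ^ 2) +
      if decision B f (fun s => X s ω) (fun s => Z s ω) t = some i
        then ENNReal.ofReal (c i) else 0) ∂P

/-- Global (joint) optimality of a strategy profile among all admissible profiles. -/
structure IsGloballyOptimal {N : ℕ} {n : Fin N → ℕ} {Ω : Type*} [MeasurableSpace Ω]
    (P : Measure Ω) (X : ℕ → Ω → Obs n) (Z : ℕ → Ω → ℕ) (B T : ℕ) (w c : Fin N → ℝ)
    (f : Scheduler n) (g : (i : Fin N) → Estimator (n i)) : Prop where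
  scheduler_admissible : f.Admissible
  estimator_admissible : ∀ i, (g i).Admissible
  cost_le : ∀ (f' : Scheduler n) (g' : (i : Fin N) → Estimator (n i)),
    f'.Admissible → (∀ i, (g' i).Admissible) →
      cost P X Z B T w c f g ≤ cost P X Z B T w c f' g'

/-- `π` is a probability density function on `ℝᵈ`. -/
structure IsPDF {d : ℕ} (π : EuclideanSpace ℝ (Fin d) → ℝ) : Prop where
  measurable : Measurable π
  nonneg : ∀ x, 0 ≤ π x
  lintegral_eq_one : ∫⁻ x, ENNReal.ofReal (π x) = 1

/-- `π` is symmetric and unimodal around `a`. -/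
def SymmUnimodal {d : ℕ} (π : EuclideanSpace ℝ (Fin d) → ℝ) (a : EuclideanSpace ℝ (Fin d)) :
    Prop :=
  ∀ x y, ‖x - a‖ ≤ ‖y - a‖ → π y ≤ π x

/-- The probabilistic model: `Xⁱ_t` has density `π i` and `Z_t` has mass function `pZ`, for every
`t`, and all the random variables `Xⁱ_t`, `Z_t` (over all `i` and `t`) are mutually independent. The
last three fields express this mutual independence: the rows `(X¹_t, …, Xᴺ_t, Z_t)` are independent
over `t`, and inside each row `X¹_t, …, Xᴺ_t, Z_t` are mutually independent. -/
structure IsModel {N : ℕ} {n : Fin N → ℕ} {Ω : Type*} [MeasurableSpace Ω] (P : Measure Ω)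
    (X : ℕ → Ω → Obs n) (Z : ℕ → Ω → ℕ)
    (π : (i : Fin N) → EuclideanSpace ℝ (Fin (n i)) → ℝ) (pZ : PMF ℕ) : Prop where
  measurable_source : ∀ t, Measurable (X t)
  measurable_harvest : ∀ t, Measurable (Z t)
  isPDF : ∀ i, IsPDF (π i)
  law_source : ∀ t i,
    P.map (fun ω => X t ω i) = volume.withDensity (fun x => ENNReal.ofReal (π i x))
  law_harvest : ∀ t, P.map (Z t) = pZ.toMeasure
  indep_time : iIndepFun (fun t ω => (X t ω, Z t ω)) P
  indep_sensors : ∀ t, iIndepFun (fun i ω => X t ω i) P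
  indep_harvest : ∀ t, IndepFun (X t) (Z t) P

open Classical in
/-- The max-deviation rule with one threshold `θ`: no transmission if all deviations are at most
`θ` (or the battery is empty); otherwise transmit the sensor with the largest deviation, the one
of smallest index in case of a tie. -/
def maxDeviationRule {N : ℕ} {n : Fin N → ℕ} (a : Obs n) (θ : ℝ) (x : Obs n) (e : ℕ) :
    Decision N :=
  if e = 0 ∨ ∀ i, ‖x i - a i‖ ≤ θ then none
  else Fin.find? (fun i => decide (∀ j, ‖x j - a j‖ ≤ ‖x i - a i‖))

open Classical in
/-- The weighted rule with per-sensor thresholds `√(θᵢ / wᵢ)`: no transmission if each deviation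
is at most its threshold (or the battery is empty); otherwise transmit the first sensor `i` above
its threshold with `wᵢ ‖xⁱ - aⁱ‖² - wⱼ ‖xʲ - aʲ‖² ≥ θᵢ - θⱼ` for every `j`. -/
def weightedRule {N : ℕ} {n : Fin N → ℕ} (w : Fin N → ℝ) (a : Obs n) (θ : Fin N → ℝ)
    (x : Obs n) (e : ℕ) : Decision N :=
  if e = 0 ∨ ∀ i, ‖x i - a i‖ ≤ √(θ i / w i) then none
  else Fin.find? (fun i => decide (√(θ i / w i) < ‖x i - a i‖ ∧
    ∀ j, θ i - θ j ≤ w i * ‖x i - a i‖ ^ 2 - w j * ‖x j - a j‖ ^ 2))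

/-- For two sensors the weighted rule is the rule with the three explicit decision regions. -/
theorem weightedRule_two {n : Fin 2 → ℕ} (w : Fin 2 → ℝ) (hw : ∀ i, 0 < w i) (a : Obs n)
    (θ : Fin 2 → ℝ) (hθ : ∀ i, 0 ≤ θ i) (x : Obs n) (e : ℕ) (he : e ≠ 0) :
    open Classical in
    weightedRule w a θ x e =
      if ‖x 0 - a 0‖ ≤ √(θ 0 / w 0) ∧ ‖x 1 - a 1‖ ≤ √(θ 1 / w 1) then none
      else if √(θ 0 / w 0) < ‖x 0 - a 0‖ ∧
        θ 0 - θ 1 ≤ w 0 * ‖x 0 - a 0‖ ^ 2 - w 1 * ‖x 1 - a 1‖ ^ 2 then some 0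
      else some 1 := by
  have key : ∀ i, √(θ i / w i) < ‖x i - a i‖ ↔ θ i < w i * ‖x i - a i‖ ^ 2 := fun i => by
    rw [Real.sqrt_lt (div_nonneg (hθ i) (hw i).le) (norm_nonneg _), div_lt_iff₀' (hw i)]
  have key' : ∀ i, ‖x i - a i‖ ≤ √(θ i / w i) ↔ w i * ‖x i - a i‖ ^ 2 ≤ θ i := fun i => by
    rw [← not_lt, key, not_lt]
  unfold weightedRule
  simp only [he, false_or, Fin.forall_fin_two, key, key', Fin.find?_succ, Fin.find?_zero,
    sub_self, le_refl, true_and, and_true, decide_eq_true_eq, Fin.succ_zero_eq_one,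
    Option.map_none]
  generalize w 0 * ‖x 0 - a 0‖ ^ 2 = p
  generalize w 1 * ‖x 1 - a 1‖ ^ 2 = q
  split_ifs <;> first | rfl | (exfalso; grind)

/-- The scheduling strategy that applies at time `t` the rule `r t` to the current observation and
the current energy level. -/
def currentStateScheduler {N : ℕ} {n : Fin N → ℕ} (r : ℕ → Obs n → ℕ → Decision N) :
    Scheduler n :=
  fun t x e _ => r t (x (Fin.last t)) (e (Fin.last t))

/-- The estimation strategy that outputs the current packet if one is received and `a` if not. -/
def defaultEstimator {d : ℕ} (a : EuclideanSpace ℝ (Fin d)) : Estimator d :=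
  fun t y => (y (Fin.last t)).getD a

end RemoteScheduling

end

open RemoteScheduling

/-! The estimators see different packets and may use their whole past, so the core of the argument
is a lower bound valid for every profile. At time `t`, an estimator that receives nothing outputs a
value `b i` fixed by the strict past, hence independent of the new observation. Given the past, no
decision beats the minimum over feasible decisions of the stage cost around `b` plus the cost-to-go
of the remaining energy. That minimum increases with each deviation `‖x i - b i‖`, and under
independent symmetric unimodal densities the mean of such a function is least at `b = a`
(`lintegral_deviation_le`). The recursion `valueFn`, a function of energy alone, is therefore a
lower bound for the optimal cost (`IsModel.valueFn_succ_le`).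

With the estimators centered at `a` the bound is attained. Write `C` for the cost-to-go of the
energy left after the decision. When it is finite, transmitting sensor `i` instead of nothing saves
`w i * d i ^ 2 - θ i`, where `θ i = c i + C (e - 1) - C e` adds to the communication cost the price
of one unit of energy; it is nonnegative because extra energy never hurts. The weighted rule picks
the largest saving, or nothing if none is positive (`weightedRule_spec`,
`stageCost_weightedRule_le`). Both one-step inequalities telescope over time. In the uniform case
the thresholds coincide, and comparing savings is comparing deviations. -/

noncomputable section

namespace RemoteScheduling

/-! ### The best center for one symmetric unimodal density -/

/-- Rearrangement inequality for two pairs of extended nonnegative reals. -/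
theorem ennreal_mul_add_mul_le {a b c d : ℝ≥0∞} (hab : a ≤ b) (hcd : c ≤ d) :
    a * d + b * c ≤ b * d + a * c := by
  obtain ⟨k, rfl⟩ := exists_add_of_le hcd
  calc a * (c + k) + b * c = a * k + (a * c + b * c) := by ring
    _ ≤ b * k + (a * c + b * c) := by gcongr
    _ = b * (c + k) + a * c := by ring

/-- Among all centers `b`, the mean of an increasing function of the distance to `b` is smallest
at the center of symmetry of a symmetric unimodal density. -/
theorem SymmUnimodal.lintegral_norm_sub_le {d : ℕ} {π : EuclideanSpace ℝ (Fin d) → ℝ}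
    {a : EuclideanSpace ℝ (Fin d)} (hπ : SymmUnimodal π a) (hm : Measurable π)
    {φ : ℝ → ℝ≥0∞} (hφ : MonotoneOn φ (Set.Ici 0)) (b : EuclideanSpace ℝ (Fin d))
    (hφm : ∀ c : EuclideanSpace ℝ (Fin d), Measurable fun x => φ ‖x - c‖) :
    ∫⁻ x, φ ‖x - a‖ ∂(volume.withDensity fun x => ENNReal.ofReal (π x)) ≤
      ∫⁻ x, φ ‖x - b‖ ∂(volume.withDensity fun x => ENNReal.ofReal (π x)) := by
  have hp : Measurable fun x => ENNReal.ofReal (π x) := hm.ennreal_ofReal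
  rw [lintegral_withDensity_eq_lintegral_mul _ hp (hφm a),
    lintegral_withDensity_eq_lintegral_mul _ hp (hφm b)]
  have key : ∀ c, Measurable ((fun x => ENNReal.ofReal (π x)) * fun x => φ ‖x - c‖) :=
    fun c => hp.mul (hφm c)
  -- The reflection `x ↦ a + b - x` preserves Lebesgue measure and exchanges the distances to `a`
  -- and `b`. Pairing each point with its image reduces the claim to the pointwise rearrangement
  -- inequality.
  have two : ∀ F : EuclideanSpace ℝ (Fin d) → ℝ≥0∞, Measurable F →
      2 * ∫⁻ x, F x = ∫⁻ x, F x + F (a + b - x) := fun F hF => by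
    rw [lintegral_add_left hF, lintegral_sub_left_eq_self, two_mul]
  have h2 : ∀ {u v : ℝ≥0∞}, 2 * u ≤ 2 * v → u ≤ v := fun {u v} h => by
    rwa [ENNReal.mul_le_mul_iff_right (by simp) (by simp)] at h
  refine h2 ?_
  rw [two _ (key a), two _ (key b)]
  refine lintegral_mono fun x => ?_
  have ha : ‖a + b - x - a‖ = ‖x - b‖ := by rw [← norm_neg]; congr 1; abel
  have hb : ‖a + b - x - b‖ = ‖x - a‖ := by rw [← norm_neg]; congr 1; abel
  simp only [Pi.mul_apply, ha, hb]
  rcases le_total ‖x - a‖ ‖x - b‖ with h | h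
  · have h1 : ENNReal.ofReal (π (a + b - x)) ≤ ENNReal.ofReal (π x) :=
      ENNReal.ofReal_le_ofReal (hπ _ _ (ha ▸ h))
    have := ennreal_mul_add_mul_le (hφ (norm_nonneg _) (norm_nonneg _) h) h1
    calc _ = φ ‖x - a‖ * ENNReal.ofReal (π x) + φ ‖x - b‖ * ENNReal.ofReal (π (a + b - x)) := by
          ring
      _ ≤ _ := this
      _ = _ := by ring
  · have h1 : ENNReal.ofReal (π x) ≤ ENNReal.ofReal (π (a + b - x)) :=
      ENNReal.ofReal_le_ofReal (hπ _ _ (ha.symm ▸ h))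
    have := ennreal_mul_add_mul_le (hφ (norm_nonneg _) (norm_nonneg _) h) h1
    calc _ = φ ‖x - b‖ * ENNReal.ofReal (π (a + b - x)) + φ ‖x - a‖ * ENNReal.ofReal (π x) := by
          ring
      _ ≤ _ := this
      _ = _ := by ring

/-! ### Several independent sensors -/

variable {N : ℕ} {n : Fin N → ℕ}

/-- The deviations of the observations from the centers `b`. -/
def deviation (b x : Obs n) : Fin N → ℝ := fun i => ‖x i - b i‖

/-- The common law of the vectors of observations. -/
def obsLaw (π : (i : Fin N) → EuclideanSpace ℝ (Fin (n i)) → ℝ) : Measure (Obs n) :=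
  Measure.pi fun i => volume.withDensity fun x => ENNReal.ofReal (π i x)

theorem IsPDF.isProbabilityMeasure {d : ℕ} {π : EuclideanSpace ℝ (Fin d) → ℝ} (h : IsPDF π) :
    IsProbabilityMeasure (volume.withDensity fun x => ENNReal.ofReal (π x)) :=
  ⟨by rw [withDensity_apply _ MeasurableSet.univ, Measure.restrict_univ, h.lintegral_eq_one]⟩

theorem isProbabilityMeasure_obsLaw {π : (i : Fin N) → EuclideanSpace ℝ (Fin (n i)) → ℝ}
    (h : ∀ i, IsPDF (π i)) : IsProbabilityMeasure (obsLaw π) := by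
  have := fun i => (h i).isProbabilityMeasure
  unfold obsLaw
  infer_instance

/-- Coordinatewise increasing functions of the deviations have the smallest mean at the centers of
symmetry. -/
theorem lintegral_deviation_le {π : (i : Fin N) → EuclideanSpace ℝ (Fin (n i)) → ℝ}
    (hpdf : ∀ i, IsPDF (π i)) {a : Obs n} (hπ : ∀ i, SymmUnimodal (π i) (a i))
    {Ψ : (Fin N → ℝ) → ℝ≥0∞} (hmono : MonotoneOn Ψ (Set.Ici 0))
    (hmeas : Measurable Ψ) (b : Obs n) :
    ∫⁻ x, Ψ (deviation a x) ∂(obsLaw π) ≤ ∫⁻ x, Ψ (deviation b x) ∂(obsLaw π) := by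
  classical
  have := fun i => (hpdf i).isProbabilityMeasure
  have hdev : ∀ b : Obs n, Measurable fun x => Ψ (deviation b x) := fun b =>
    hmeas.comp (measurable_pi_lambda _ fun i => ((measurable_pi_apply i).sub_const _).norm)
  -- The centers are moved from `b` to `a` one coordinate at a time. For coordinate `i`, the
  -- integral over `x i` is taken innermost, so the one-sensor inequality applies with the other
  -- deviations frozen.
  have key : ∀ S : Finset (Fin N), ∫⁻ x, Ψ (deviation (S.piecewise a b) x) ∂(obsLaw π) ≤
      ∫⁻ x, Ψ (deviation b x) ∂(obsLaw π) := by
    intro S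
    induction S using Finset.induction_on with
    | empty => simp
    | insert i S hi ih =>
      refine le_trans ?_ ih
      unfold obsLaw
      rw [lintegral_eq_lmarginal_univ a, lintegral_eq_lmarginal_univ a,
        lmarginal_erase' _ (hdev _) (Finset.mem_univ i),
        lmarginal_erase' _ (hdev _) (Finset.mem_univ i)]
      refine lmarginal_mono (fun x => ?_) a
      have hval : ∀ c : Obs n, ∀ y, deviation c (Function.update x i y) =
          Function.update (deviation c x) i ‖y - c i‖ := fun c y => by
        ext j
        by_cases hj : j = i
        · subst hj; simp [deviation]
        · simp [deviation, hj]
      have hupd : Function.update (deviation ((insert i S).piecewise a b) x) i =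
          Function.update (deviation (S.piecewise a b) x) i := by
        ext r j
        by_cases hj : j = i
        · subst hj; simp
        · simp [deviation, hj, Finset.piecewise]
      simp only [hval, hupd]
      rw [Finset.piecewise_insert_self]
      refine (hπ i).lintegral_norm_sub_le (hpdf i).measurable (φ := fun r =>
        Ψ (Function.update (deviation (S.piecewise a b) x) i r)) ?_ _ ?_
      · intro r hr s hs hrs
        refine hmono ?_ ?_ (update_le_update_iff'.2 hrs)
        · exact le_update_iff.2 ⟨hr, fun j _ => norm_nonneg _⟩
        · exact le_update_iff.2 ⟨hs, fun j _ => norm_nonneg _⟩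
      · intro c
        exact hmeas.comp ((measurable_update _).comp (measurable_id.sub_const c).norm)
  simpa using key Finset.univ

/-! ### Value functions of the dynamic program -/

/-- The energy spent by a decision. -/
def spent (u : Decision N) : ℕ := if u = none then 0 else 1

/-- The one-step cost of a decision when the deviations from the default estimates are `d`. -/
def stageCost (w c : Fin N → ℝ) (u : Decision N) (d : Fin N → ℝ) : ℝ≥0∞ :=
  ∑ i, if u = some i then ENNReal.ofReal (c i) else ENNReal.ofReal (w i * d i ^ 2)

/-- The minimum over the feasible decisions at the energy level `e` of the one-step cost plus the
cost-to-go `C` of the remaining energy. -/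
def bestCost (w c : Fin N → ℝ) (C : ℕ → ℝ≥0∞) (e : ℕ) (d : Fin N → ℝ) : ℝ≥0∞ :=
  ⨅ u : {u : Decision N // e = 0 → u = none}, stageCost w c u d + C (e - spent u.1)

/-- The mean of `V` at the next energy level when the energy `e` is left after transmission. -/
def harvestMean (B : ℕ) (pZ : PMF ℕ) (V : ℕ → ℝ≥0∞) (e : ℕ) : ℝ≥0∞ :=
  ∫⁻ z, V (min (e + z) B) ∂pZ.toMeasure

/-- The optimal cost-to-go with `k` steps left at the energy level `e`. -/
def valueFn (π : (i : Fin N) → EuclideanSpace ℝ (Fin (n i)) → ℝ) (pZ : PMF ℕ) (a : Obs n) (B : ℕ)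
    (w c : Fin N → ℝ) : ℕ → ℕ → ℝ≥0∞
  | 0 => fun _ => 0
  | k + 1 => fun e => ∫⁻ x,
      bestCost w c (harvestMean B pZ (valueFn π pZ a B w c k)) e (deviation a x) ∂(obsLaw π)

theorem measurable_stageCost (w c : Fin N → ℝ) (u : Decision N) : Measurable (stageCost w c u) := by
  unfold stageCost
  refine Finset.measurable_sum _ fun i _ => ?_
  split_ifs
  · exact measurable_const
  · exact (((measurable_pi_apply i).pow_const 2).const_mul _).ennreal_ofReal

theorem measurable_bestCost (w c : Fin N → ℝ) (C : ℕ → ℝ≥0∞) (e : ℕ) :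
    Measurable (bestCost w c C e) :=
  Measurable.iInf fun u => (measurable_stageCost w c u.1).add_const _

theorem stageCost_mono {w : Fin N → ℝ} (hw : ∀ i, 0 < w i) (c : Fin N → ℝ) (u : Decision N) :
    MonotoneOn (stageCost w c u) (Set.Ici 0) := by
  intro d hd d' _ h
  refine Finset.sum_le_sum fun i _ => ?_
  split_ifs
  · exact le_rfl
  · exact ENNReal.ofReal_le_ofReal (mul_le_mul_of_nonneg_left
      (pow_le_pow_left₀ (hd i) (h i) 2) (hw i).le)

theorem bestCost_mono {w : Fin N → ℝ} (hw : ∀ i, 0 < w i) (c : Fin N → ℝ) (C : ℕ → ℝ≥0∞)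
    (e : ℕ) : MonotoneOn (bestCost w c C e) (Set.Ici 0) := fun _ hd _ hd' h =>
  iInf_mono fun u => add_le_add (stageCost_mono hw c u.1 hd hd' h) le_rfl

/-- A decision feasible at a lower energy stays feasible at a higher one and leaves at least as much
energy. This is the source of the nonnegativity of the thresholds. -/
theorem bestCost_antitone (w c : Fin N → ℝ) {C : ℕ → ℝ≥0∞} (hC : Antitone C) (d : Fin N → ℝ) :
    Antitone fun e => bestCost w c C e d := by
  intro e e' h
  refine le_iInf fun u => (iInf_le _ ⟨u.1, fun h0 => u.2 (by omega)⟩).trans ?_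
  exact add_le_add le_rfl (hC (Nat.sub_le_sub_right h _))

theorem harvestMean_antitone (B : ℕ) (pZ : PMF ℕ) {V : ℕ → ℝ≥0∞} (hV : Antitone V) :
    Antitone (harvestMean B pZ V) := fun _ _ h =>
  lintegral_mono fun z => hV (min_le_min_right B (Nat.add_le_add_right h z))

section valueFn

variable (π : (i : Fin N) → EuclideanSpace ℝ (Fin (n i)) → ℝ) (pZ : PMF ℕ) (a : Obs n) (B : ℕ)
  (w c : Fin N → ℝ)

theorem valueFn_antitone (k : ℕ) : Antitone (valueFn π pZ a B w c k) := by
  induction k with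
  | zero => exact fun _ _ _ => le_rfl
  | succ k ih => exact fun _ _ h => lintegral_mono fun x =>
      bestCost_antitone w c (harvestMean_antitone B pZ ih) _ h

theorem harvestMean_valueFn_antitone (k : ℕ) :
    Antitone (harvestMean B pZ (valueFn π pZ a B w c k)) :=
  harvestMean_antitone B pZ (valueFn_antitone π pZ a B w c k)

-- Silence is always feasible and has the same mean cost at every step. The bound serves the
-- degenerate case: an infinite cost-to-go forces silence to have infinite mean cost in a single
-- step.
variable {π} in
theorem valueFn_le (h : ∀ i, IsPDF (π i)) (k e : ℕ) :
    valueFn π pZ a B w c k e ≤ k * ∫⁻ x, stageCost w c none (deviation a x) ∂(obsLaw π) := by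
  have := isProbabilityMeasure_obsLaw h
  set S := ∫⁻ x, stageCost w c none (deviation a x) ∂(obsLaw π)
  induction k generalizing e with
  | zero => simp [valueFn]
  | succ k ih =>
    have hC : ∀ e, harvestMean B pZ (valueFn π pZ a B w c k) e ≤ k * S := fun e =>
      (lintegral_mono fun z => ih _).trans (by simp)
    calc valueFn π pZ a B w c (k + 1) e
        ≤ ∫⁻ x, stageCost w c none (deviation a x) + k * S ∂(obsLaw π) :=
          lintegral_mono fun x => (iInf_le _ ⟨none, fun _ => rfl⟩).trans
            (add_le_add le_rfl (hC _))
      _ = S + k * S := by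
          rw [lintegral_add_right _ measurable_const]
          simp [S]
      _ = ((k + 1 : ℕ) : ℝ≥0∞) * S := by push_cast; ring

end valueFn

/-! ### Thresholds and the minimizing decision -/

/-- The threshold for sensor `i` at the energy level `e` when the cost-to-go is `C`. -/
def threshold (c : Fin N → ℝ) (C : ℕ → ℝ≥0∞) (i : Fin N) (e : ℕ) : ℝ :=
  if C (e - 1) = ∞ then c i else c i + ((C (e - 1)).toReal - (C e).toReal)

theorem threshold_nonneg {c : Fin N → ℝ} (hc : ∀ i, 0 ≤ c i) {C : ℕ → ℝ≥0∞} (hC : Antitone C)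
    (i : Fin N) (e : ℕ) : 0 ≤ threshold c C i e := by
  unfold threshold
  split_ifs with h
  · exact hc i
  · exact add_nonneg (hc i) (sub_nonneg.2 (ENNReal.toReal_mono h (hC (Nat.sub_le e 1))))

/-- The one-step cost in terms of the gain of a transmission. -/
theorem stageCost_eq_ofReal {w c : Fin N → ℝ} (hw : ∀ i, 0 < w i) (hc : ∀ i, 0 ≤ c i)
    (u : Decision N) (d : Fin N → ℝ) :
    stageCost w c u d = ENNReal.ofReal ((∑ i, w i * d i ^ 2) -
      u.elim 0 fun i => w i * d i ^ 2 - c i) := by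
  have hnn : ∀ i, 0 ≤ w i * d i ^ 2 := fun i => mul_nonneg (hw i).le (sq_nonneg _)
  have h : stageCost w c u d =
      ENNReal.ofReal (∑ i, if u = some i then c i else w i * d i ^ 2) := by
    unfold stageCost
    rw [ENNReal.ofReal_sum_of_nonneg]
    · exact Finset.sum_congr rfl fun i _ => by split_ifs <;> rfl
    · intro i _
      split_ifs
      exacts [hc i, hnn i]
  rw [h]
  congr 1
  cases u with
  | none => simp
  | some k =>
    simp only [Option.some.injEq, Option.elim_some]
    rw [← Finset.add_sum_erase _ _ (Finset.mem_univ k),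
      ← Finset.add_sum_erase _ (fun i => w i * d i ^ 2) (Finset.mem_univ k)]
    rw [Finset.sum_congr rfl fun i hi => if_neg (Finset.ne_of_mem_erase hi).symm]
    simp
    ring

/-- The characterization of the decisions of the weighted rule. -/
theorem weightedRule_spec {w : Fin N → ℝ} (hw : ∀ i, 0 < w i) (a : Obs n) {θ : Fin N → ℝ}
    (hθ : ∀ i, 0 ≤ θ i) (x : Obs n) {e : ℕ} (he : e ≠ 0) (v : Decision N) :
    (v.elim 0 fun i => w i * deviation a x i ^ 2 - θ i) ≤
      (weightedRule w a θ x e).elim 0 fun i => w i * deviation a x i ^ 2 - θ i := by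
  classical
  have key : ∀ i, √(θ i / w i) < ‖x i - a i‖ ↔ θ i < w i * ‖x i - a i‖ ^ 2 := fun i => by
    rw [Real.sqrt_lt (div_nonneg (hθ i) (hw i).le) (norm_nonneg _), div_lt_iff₀' (hw i)]
  have key' : ∀ i, ‖x i - a i‖ ≤ √(θ i / w i) ↔ w i * ‖x i - a i‖ ^ 2 ≤ θ i := fun i => by
    rw [← not_lt, key, not_lt]
  unfold weightedRule
  simp only [he, false_or, key, key', deviation]
  split_ifs with h
  · cases v with
    | none => simp
    | some i => simpa using h i
  · push Not at h
    obtain ⟨i₀, hi₀⟩ := h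
    -- A maximizer `m` of the saving passes both tests, since its saving is at least the positive
    -- one of `i₀`. Hence the search cannot fail.
    obtain ⟨m, -, hm⟩ := Finset.exists_max_image Finset.univ
      (fun i => w i * ‖x i - a i‖ ^ 2 - θ i) ⟨i₀, Finset.mem_univ _⟩
    generalize hf : Fin.find? (fun i => decide (θ i < w i * ‖x i - a i‖ ^ 2 ∧
      ∀ j, θ i - θ j ≤ w i * ‖x i - a i‖ ^ 2 - w j * ‖x j - a j‖ ^ 2)) = r
    cases r with
    | none =>
      rw [Fin.find?_eq_none_iff] at hf
      have := hf m
      simp only [decide_eq_false_iff_not] at this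
      refine absurd ⟨?_, fun j => ?_⟩ this
      · linarith [hm i₀ (Finset.mem_univ _)]
      · linarith [hm j (Finset.mem_univ _)]
    | some i =>
      have := (Fin.find?_eq_some_iff.1 hf).1
      simp only [decide_eq_true_eq] at this
      cases v with
      | none => simpa using this.1.le
      | some j => simpa using by linarith [this.2 j]

theorem weightedRule_zero (w : Fin N → ℝ) (a : Obs n) (θ : Fin N → ℝ) (x : Obs n) :
    weightedRule w a θ x 0 = none := by
  simp [weightedRule]

/-- With unit weights and equal thresholds the weighted rule is the max-deviation rule. -/
theorem maxDeviationRule_sqrt (a : Obs n) (θ : ℝ) (x : Obs n) (e : ℕ) :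
    maxDeviationRule a (√θ) x e = weightedRule (fun _ => 1) a (fun _ => θ) x e := by
  classical
  unfold maxDeviationRule weightedRule
  simp only [div_one, sub_self, one_mul, sub_nonneg,
    pow_le_pow_iff_left₀ (norm_nonneg _) (norm_nonneg _) two_ne_zero]
  split_ifs with h
  · rfl
  · push Not at h
    obtain ⟨-, i₀, hi₀⟩ := h
    congr 1
    ext i
    simp only [decide_eq_decide]
    -- A sensor of maximal deviation exceeds the threshold automatically, because `i₀` does.
    exact ⟨fun hj => ⟨hi₀.trans_le (hj i₀), hj⟩, fun hj => hj.2⟩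

/-- The weighted rule attains the minimal cost when the cost-to-go is finite. -/
theorem stageCost_weightedRule_le {w c : Fin N → ℝ} (hw : ∀ i, 0 < w i) (hc : ∀ i, 0 ≤ c i)
    {C : ℕ → ℝ≥0∞} (hC : Antitone C) (a x : Obs n) {e : ℕ} (he : e ≠ 0) (hfin : C (e - 1) ≠ ∞) :
    let u := weightedRule w a (fun i => threshold c C i e) x e
    stageCost w c u (deviation a x) + C (e - spent u) ≤ bestCost w c C e (deviation a x) := by
  intro u
  have hfin' : C e ≠ ∞ := ne_top_of_le_ne_top hfin (hC (Nat.sub_le e 1))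
  have hv : ∀ v : Decision N, C (e - spent v) ≠ ∞ := fun v => by
    unfold spent; split_ifs
    exacts [hfin', hfin]
  have hst : ∀ v : Decision N, stageCost w c v (deviation a x) ≠ ∞ := fun v => by
    rw [stageCost_eq_ofReal hw hc]; exact ENNReal.ofReal_ne_top
  -- The total cost is a quantity independent of the decision minus the saving of the decision, so
  -- minimizing cost is maximizing saving.
  have hre : ∀ v : Decision N, (stageCost w c v (deviation a x) + C (e - spent v)).toReal =
      (∑ i, w i * deviation a x i ^ 2) + (C e).toReal -
        v.elim 0 fun i => w i * deviation a x i ^ 2 - threshold c C i e := fun v => by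
    have hnn : 0 ≤ (∑ i, w i * deviation a x i ^ 2) -
        v.elim 0 fun i => w i * deviation a x i ^ 2 - c i := by
      have h0 : ∀ i ∈ Finset.univ, 0 ≤ w i * deviation a x i ^ 2 := fun i _ =>
        mul_nonneg (hw i).le (sq_nonneg _)
      cases v with
      | none => simpa using Finset.sum_nonneg h0
      | some k =>
        have := Finset.single_le_sum h0 (Finset.mem_univ k)
        simp only [Option.elim_some]
        linarith [hc k]
    rw [ENNReal.toReal_add (hst v) (hv v), stageCost_eq_ofReal hw hc, ENNReal.toReal_ofReal hnn]
    cases v with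
    | none => simp [spent]
    | some k =>
      simp only [Option.elim_some, spent, threshold, if_neg hfin, reduceCtorEq, if_false]
      ring
  refine le_iInf fun v => ?_
  rw [← ENNReal.toReal_le_toReal (ENNReal.add_ne_top.2 ⟨hst u, hv u⟩)
    (ENNReal.add_ne_top.2 ⟨hst v, hv v⟩), hre, hre]
  exact sub_le_sub_left (weightedRule_spec hw a (threshold_nonneg hc hC · e) x he v) _

/-! ### Measurability for packets, decisions and histories -/

theorem measurable_some {α : Type*} [MeasurableSpace α] : Measurable (some : α → Option α) :=
  fun _ hs => hs

theorem measurable_of_comp_some {α β : Type*} [MeasurableSpace α] [MeasurableSpace β]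
    {f : Option α → β} (h : Measurable fun x => f (some x)) : Measurable f :=
  fun _ hs => h hs

instance instMeasurableSingletonClassOption {α : Type*} [MeasurableSpace α]
    [MeasurableSingletonClass α] : MeasurableSingletonClass (Option α) where
  measurableSet_singleton y := by
    cases y with
    | none =>
      change MeasurableSet (some ⁻¹' {none})
      have : (some ⁻¹' {none} : Set α) = ∅ := by ext; simp
      rw [this]
      exact MeasurableSet.empty
    | some x =>
      change MeasurableSet (some ⁻¹' {some x})
      have : (some ⁻¹' {some x} : Set α) = {x} := by ext; simp
      rw [this]
      exact measurableSet_singleton x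

theorem measurable_received : Measurable fun p : Obs n × Decision N => received p.1 p.2 := by
  refine measurable_from_prod_countable_left fun u => measurable_pi_lambda _ fun i => ?_
  by_cases h : u = some i
  · simp only [received, if_pos h]
    exact measurable_some.comp (measurable_pi_apply i)
  · simpa only [received, if_neg h] using measurable_const

theorem measurable_nextEnergy (B : ℕ) :
    Measurable fun p : ℕ × Decision N × ℕ => nextEnergy B p.1 p.2.1 p.2.2 :=
  measurable_of_countable _

theorem measurable_snoc {α : Type*} [MeasurableSpace α] (t : ℕ) :
    Measurable fun p : (Fin t → α) × α =>
      (Fin.snoc (α := fun _ => α) p.1 p.2 : Fin (t + 1) → α) := by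
  refine measurable_pi_lambda _ fun s => ?_
  refine Fin.lastCases ?_ (fun s => ?_) s
  · simpa using measurable_snd
  · simpa using (measurable_fst (α := Fin t → α) (β := α)).eval

/-! ### Causality and measurability along a realization -/

/-- The energy and packet histories along the realization `ξ` of observations and harvests. -/
def hist (B : ℕ) (f : Scheduler n) (ξ : ℕ → Obs n × ℕ) (t : ℕ) :
    (Fin (t + 1) → ℕ) × (Fin t → Packets n) :=
  history B f (fun s => (ξ s).1) (fun s => (ξ s).2) t

/-- The decision along the realization `ξ`. -/
def dec (B : ℕ) (f : Scheduler n) (ξ : ℕ → Obs n × ℕ) (t : ℕ) : Decision N :=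
  decision B f (fun s => (ξ s).1) (fun s => (ξ s).2) t

/-- The energy level along the realization `ξ`. -/
def energy (B : ℕ) (f : Scheduler n) (ξ : ℕ → Obs n × ℕ) (t : ℕ) : ℕ :=
  (hist B f ξ t).1 (Fin.last t)

/-- The cost at time `t` along the realization `ξ`. -/
def stepCost (B : ℕ) (w c : Fin N → ℝ) (f : Scheduler n) (g : (i : Fin N) → Estimator (n i))
    (ξ : ℕ → Obs n × ℕ) (t : ℕ) : ℝ≥0∞ :=
  ∑ i, (ENNReal.ofReal (w i * ‖(ξ t).1 i -
        estimate B f (fun s => (ξ s).1) (fun s => (ξ s).2) i (g i) t‖ ^ 2) +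
      if dec B f ξ t = some i then ENNReal.ofReal (c i) else 0)

variable {B : ℕ} {f : Scheduler n} {ξ ζ : ℕ → Obs n × ℕ} {t : ℕ}

theorem hist_succ : hist B f ξ (t + 1) =
    (Fin.snoc (α := fun _ => ℕ) (hist B f ξ t).1
        (nextEnergy B (energy B f ξ t) (dec B f ξ t) (ξ t).2),
      Fin.snoc (α := fun _ => Packets n) (hist B f ξ t).2
        (received (ξ t).1 (dec B f ξ t))) := rfl

theorem energy_zero : energy B f ξ 0 = B := rfl

theorem energy_succ : energy B f ξ (t + 1) =
    min (energy B f ξ t - spent (dec B f ξ t) + (ξ t).2) B := by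
  rw [energy, hist_succ]
  simp only [Fin.snoc_last]
  rfl

theorem dec_eq : dec B f ξ t =
    f t (fun s => (ξ s).1) (hist B f ξ t).1 (hist B f ξ t).2 := rfl

theorem dec_congr_of_hist (h : ∀ s ≤ t, (ξ s).1 = (ζ s).1) (hh : hist B f ξ t = hist B f ζ t) :
    dec B f ξ t = dec B f ζ t := by
  rw [dec_eq, dec_eq, hh, funext fun s : Fin (t + 1) => h s (Nat.lt_succ_iff.1 s.2)]

theorem hist_congr (h : ∀ s < t, ξ s = ζ s) : hist B f ξ t = hist B f ζ t := by
  induction t with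
  | zero => rfl
  | succ t ih =>
    have ih := ih fun s hs => h s (hs.trans t.lt_succ_self)
    have hd := dec_congr_of_hist (fun s hs => by rw [h s (Nat.lt_succ_iff.2 hs)]) ih
    rw [hist_succ, hist_succ, energy, energy, ih, hd, h t t.lt_succ_self]

/-- The decision uses the observation at time `t` but not the harvest at time `t`; the harvest can
thus be averaged after the decision is fixed. -/
theorem dec_congr (h : ∀ s < t, ξ s = ζ s) (ht : (ξ t).1 = (ζ t).1) :
    dec B f ξ t = dec B f ζ t :=
  dec_congr_of_hist (fun s hs => by
    rcases hs.lt_or_eq with hs | rfl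
    exacts [congrArg _ (h s hs), ht]) (hist_congr h)

theorem energy_congr (h : ∀ s < t, ξ s = ζ s) : energy B f ξ t = energy B f ζ t := by
  rw [energy, energy, hist_congr h]

theorem dec_eq_none (hf : f.Admissible) (h : energy B f ξ t = 0) : dec B f ξ t = none :=
  hf.feasible _ _ _ _ h

theorem estimate_congr {i : Fin N} {g : Estimator (n i)} (h : ∀ s ≤ t, ξ s = ζ s) :
    estimate B f (fun s => (ξ s).1) (fun s => (ξ s).2) i g t =
      estimate B f (fun s => (ζ s).1) (fun s => (ζ s).2) i g t := by
  unfold estimate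
  congr 1
  ext1 s
  have hs : (s : ℕ) ≤ t := Nat.lt_succ_iff.1 s.2
  have hd : dec B f ξ s = dec B f ζ s :=
    dec_congr (fun r hr => h r (hr.le.trans hs)) (congrArg _ (h s hs))
  change received (ξ s).1 (dec B f ξ s) i = received (ζ s).1 (dec B f ζ s) i
  rw [h s hs, hd]

theorem stepCost_congr {w c : Fin N → ℝ} {g : (i : Fin N) → Estimator (n i)}
    (h : ∀ s ≤ t, ξ s = ζ s) : stepCost B w c f g ξ t = stepCost B w c f g ζ t := by
  unfold stepCost
  rw [h t le_rfl, dec_congr (fun r hr => h r hr.le) (congrArg _ (h t le_rfl))]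
  simp only [estimate_congr h]

theorem measurable_dec_of_hist (hf : f.Admissible)
    (h : Measurable fun ξ : ℕ → Obs n × ℕ => hist B f ξ t) :
    Measurable fun ξ : ℕ → Obs n × ℕ => dec B f ξ t :=
  (hf.measurable t).comp ((measurable_pi_lambda _ fun s : Fin (t + 1) =>
    measurable_fst.comp (measurable_pi_apply (s : ℕ))).prodMk h)

theorem measurable_hist (hf : f.Admissible) (t : ℕ) :
    Measurable fun ξ : ℕ → Obs n × ℕ => hist B f ξ t := by
  induction t with
  | zero => exact measurable_const
  | succ t ih =>
    have hd := measurable_dec_of_hist hf ih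
    have he : Measurable fun ξ : ℕ → Obs n × ℕ => energy B f ξ t :=
      (measurable_pi_apply _).comp ih.fst
    refine Measurable.prodMk ?_ ?_
    · exact (measurable_snoc (t + 1)).comp (ih.fst.prodMk ((measurable_nextEnergy B).comp
        (he.prodMk (hd.prodMk (measurable_snd.comp (measurable_pi_apply t))))))
    · exact (measurable_snoc t).comp (ih.snd.prodMk (measurable_received.comp
        ((measurable_fst.comp (measurable_pi_apply t)).prodMk hd)))

theorem measurable_dec (hf : f.Admissible) (t : ℕ) :
    Measurable fun ξ : ℕ → Obs n × ℕ => dec B f ξ t :=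
  measurable_dec_of_hist hf (measurable_hist hf t)

theorem measurable_energy (hf : f.Admissible) (t : ℕ) :
    Measurable fun ξ : ℕ → Obs n × ℕ => energy B f ξ t :=
  (measurable_pi_apply _).comp (measurable_hist hf t).fst

theorem measurable_stepCost {w c : Fin N → ℝ} (hf : f.Admissible)
    {g : (i : Fin N) → Estimator (n i)} (hg : ∀ i, (g i).Admissible) (t : ℕ) :
    Measurable fun ξ : ℕ → Obs n × ℕ => stepCost B w c f g ξ t := by
  have hx : ∀ s, Measurable fun ξ : ℕ → Obs n × ℕ => (ξ s).1 := fun s =>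
    measurable_fst.comp (measurable_pi_apply s)
  refine Finset.measurable_sum _ fun i _ => Measurable.fun_add ?_ ?_
  · have hest : Measurable fun ξ : ℕ → Obs n × ℕ =>
        estimate B f (fun s => (ξ s).1) (fun s => (ξ s).2) i (g i) t :=
      (hg i t).comp (measurable_pi_lambda _ fun s => (measurable_pi_apply i).comp
        (measurable_received.comp ((hx s).prodMk (measurable_dec hf s))))
    have hxi : Measurable fun ξ : ℕ → Obs n × ℕ => (ξ t).1 i := (measurable_pi_apply i).comp (hx t)
    exact (((hxi.sub hest).norm.pow_const 2).const_mul _).ennreal_ofReal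
  · exact Measurable.ite ((measurable_dec hf t) (measurableSet_singleton _)) measurable_const
      measurable_const

/-! ### Default estimates and the stage cost -/

/-- The default estimates: those that are used when nothing is received at time `t`. -/
def defaultEstimate (B : ℕ) (f : Scheduler n) (g : (i : Fin N) → Estimator (n i))
    (ξ : ℕ → Obs n × ℕ) (t : ℕ) : Obs n := fun i =>
  g i t (Fin.snoc (α := fun _ => Option (EuclideanSpace ℝ (Fin (n i))))
    (fun s : Fin t => received (ξ s).1 (dec B f ξ s) i) none)

theorem defaultEstimate_congr {g : (i : Fin N) → Estimator (n i)} (h : ∀ s < t, ξ s = ζ s) :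
    defaultEstimate B f g ξ t = defaultEstimate B f g ζ t := by
  ext1 i
  unfold defaultEstimate
  congr 2
  ext1 s
  rw [h s s.2, dec_congr (fun r hr => h r (hr.trans s.2)) (congrArg _ (h s s.2))]

theorem estimate_eq_defaultEstimate {g : (i : Fin N) → Estimator (n i)} {i : Fin N}
    (h : dec B f ξ t ≠ some i) :
    estimate B f (fun s => (ξ s).1) (fun s => (ξ s).2) i (g i) t =
      defaultEstimate B f g ξ t i := by
  unfold estimate defaultEstimate
  congr 1
  ext1 s
  refine Fin.lastCases ?_ (fun s => ?_) s
  · rw [Fin.snoc_last]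
    exact if_neg h
  · rw [Fin.snoc_castSucc]
    rfl

/-- Sensors that are not scheduled are estimated by their default; for the scheduled one the
nonnegative estimation error is dropped. This removes the estimators from the problem, except for
their default values. -/
theorem stageCost_le_stepCost (w c : Fin N → ℝ) (g : (i : Fin N) → Estimator (n i)) :
    stageCost w c (dec B f ξ t) (deviation (defaultEstimate B f g ξ t) (ξ t).1) ≤
      stepCost B w c f g ξ t := by
  refine Finset.sum_le_sum fun i _ => ?_
  split_ifs with h
  · exact le_add_self
  · rw [estimate_eq_defaultEstimate h, add_zero]
    rfl

theorem stepCost_defaultEstimator (w c : Fin N → ℝ) (a : Obs n) :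
    stepCost B w c f (fun i => defaultEstimator (a i)) ξ t =
      stageCost w c (dec B f ξ t) (deviation a (ξ t).1) := by
  refine Finset.sum_congr rfl fun i _ => ?_
  have hest : estimate B f (fun s => (ξ s).1) (fun s => (ξ s).2) i (defaultEstimator (a i)) t =
      (if dec B f ξ t = some i then some ((ξ t).1 i) else none).getD (a i) := rfl
  rw [hest]
  split_ifs with h <;> simp [deviation]

/-! ### Averaging over one time step -/

/-- A functional of the realization up to time `t` is averaged by first averaging over the
observation and the harvest at time `t`. -/
theorem IsModel.lintegral_eq {Ω : Type*} [MeasurableSpace Ω] {P : Measure Ω}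
    [IsProbabilityMeasure P] {X : ℕ → Ω → Obs n} {Z : ℕ → Ω → ℕ}
    {π : (i : Fin N) → EuclideanSpace ℝ (Fin (n i)) → ℝ} {pZ : PMF ℕ} (hm : IsModel P X Z π pZ)
    {Φ : (ℕ → Obs n × ℕ) → ℝ≥0∞} (hΦ : Measurable Φ) (t : ℕ)
    (hdep : ∀ ξ ζ, (∀ s ≤ t, ξ s = ζ s) → Φ ξ = Φ ζ) :
    ∫⁻ ω, Φ (fun s => (X s ω, Z s ω)) ∂P =
      ∫⁻ ω, ∫⁻ x, ∫⁻ z, Φ (Function.update (fun s => (X s ω, Z s ω)) t (x, z))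
        ∂pZ.toMeasure ∂(obsLaw π) ∂P := by
  classical
  have hrow : ∀ s, Measurable fun ω => (X s ω, Z s ω) := fun s =>
    (hm.measurable_source s).prodMk (hm.measurable_harvest s)
  have hX : P.map (X t) = obsLaw π := by
    have := (iIndepFun_iff_map_fun_eq_pi_map fun i =>
      ((measurable_pi_apply i).comp (hm.measurable_source t)).aemeasurable).1 (hm.indep_sensors t)
    simp only [Function.comp_def, hm.law_source] at this
    exact this
  have hXZ : P.map (fun ω => (X t ω, Z t ω)) = (obsLaw π).prod pZ.toMeasure := by
    rw [(indepFun_iff_map_prod_eq_prod_map_map (hm.measurable_source t).aemeasurable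
      (hm.measurable_harvest t).aemeasurable).1 (hm.indep_harvest t), hX, hm.law_harvest]
  have := isProbabilityMeasure_obsLaw hm.isPDF
  let past : Ω → (Finset.range t → Obs n × ℕ) := fun ω s => (X s ω, Z s ω)
  have hpast : Measurable past := measurable_pi_lambda _ fun s => hrow s
  -- The padding `(0, 0)` is harmless: time `t` is overwritten by the update and `Φ` ignores later
  -- times.
  let ext : (Finset.range t → Obs n × ℕ) → ℕ → Obs n × ℕ := fun r s =>
    if h : s ∈ Finset.range t then r ⟨s, h⟩ else (0, 0)
  have hext : Measurable ext := measurable_pi_lambda _ fun s => by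
    by_cases h : s ∈ Finset.range t
    · simpa only [ext, dif_pos h] using measurable_pi_apply _
    · simpa only [ext, dif_neg h] using measurable_const
  have hind : IndepFun past (fun ω => (X t ω, Z t ω)) P := by
    have := hm.indep_time.indepFun_finset (Finset.range t) {t} (by simp) hrow
    exact this.comp measurable_id
      (measurable_pi_apply (⟨t, Finset.mem_singleton_self t⟩ : ({t} : Finset ℕ)))
  have hjoint := (indepFun_iff_map_prod_eq_prod_map_map hpast.aemeasurable
    (hrow t).aemeasurable).1 hind
  have hupd : Measurable fun p : (Finset.range t → Obs n × ℕ) × (Obs n × ℕ) =>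
      Function.update (ext p.1) t p.2 := measurable_pi_lambda _ fun s => by
    by_cases h : s = t
    · subst h
      simpa using measurable_snd
    · simpa [h] using (hext.comp measurable_fst).eval (a := s)
  have hF : Measurable fun p : (Finset.range t → Obs n × ℕ) × (Obs n × ℕ) =>
      Φ (Function.update (ext p.1) t p.2) := hΦ.comp hupd
  have hagree : ∀ ω (y : Obs n × ℕ), Φ (Function.update (ext (past ω)) t y) =
      Φ (Function.update (fun s => (X s ω, Z s ω)) t y) := fun ω y =>
    hdep _ _ fun s hs => by
      by_cases h : s = t
      · subst h; simp
      · have : s < t := lt_of_le_of_ne hs h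
        simp [h, ext, past, this]
  calc ∫⁻ ω, Φ (fun s => (X s ω, Z s ω)) ∂P
      = ∫⁻ ω, Φ (Function.update (ext (past ω)) t (X t ω, Z t ω)) ∂P :=
        lintegral_congr fun ω => by
          rw [hagree, Function.update_eq_self t fun s => (X s ω, Z s ω)]
    _ = ∫⁻ p, Φ (Function.update (ext p.1) t p.2) ∂(P.map past).prod
          ((obsLaw π).prod pZ.toMeasure) := by
        rw [← hXZ, ← hjoint, lintegral_map hF (hpast.prodMk (hrow t))]
    _ = ∫⁻ ω, ∫⁻ y, Φ (Function.update (ext (past ω)) t y)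
          ∂((obsLaw π).prod pZ.toMeasure) ∂P := by
        rw [lintegral_prod _ hF.aemeasurable, lintegral_map hF.lintegral_prod_right' hpast]
    _ = _ := lintegral_congr fun ω => by
        have hFω : Measurable fun y => Φ (Function.update (ext (past ω)) t y) :=
          hF.comp (measurable_prodMk_left (x := past ω))
        rw [lintegral_prod _ hFω.aemeasurable]
        simp only [hagree]

/-! ### Dynamic programming inequalities -/

section optimality

variable {Ω : Type*} [MeasurableSpace Ω] {P : Measure Ω} [IsProbabilityMeasure P]
  {X : ℕ → Ω → Obs n} {Z : ℕ → Ω → ℕ} {π : (i : Fin N) → EuclideanSpace ℝ (Fin (n i)) → ℝ}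
  {pZ : PMF ℕ} {a : Obs n} {w c : Fin N → ℝ}

/-- Averaging the cost-to-go over the harvest at time `t`. -/
theorem lintegral_energy_succ (V : ℕ → ℝ≥0∞) (ξ : ℕ → Obs n × ℕ) (x : Obs n) :
    ∫⁻ z, V (energy B f (Function.update ξ t (x, z)) (t + 1)) ∂pZ.toMeasure =
      harvestMean B pZ V (energy B f ξ t - spent (dec B f (Function.update ξ t (x, 0)) t)) := by
  refine lintegral_congr fun z => ?_
  rw [energy_succ, energy_congr (ζ := ξ) fun s hs => by simp [hs.ne],
    dec_congr (ζ := Function.update ξ t (x, 0)) (fun s hs => by simp [hs.ne]) (by simp)]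
  simp

theorem measurable_step (hf : f.Admissible) {g : (i : Fin N) → Estimator (n i)}
    (hg : ∀ i, (g i).Admissible) (V : ℕ → ℝ≥0∞) (t : ℕ) :
    Measurable fun ξ : ℕ → Obs n × ℕ => stepCost B w c f g ξ t + V (energy B f ξ (t + 1)) :=
  (measurable_stepCost hf hg t).add ((measurable_of_countable V).comp (measurable_energy hf _))

theorem step_congr {g : (i : Fin N) → Estimator (n i)} (V : ℕ → ℝ≥0∞)
    (h : ∀ s ≤ t, ξ s = ζ s) :
    stepCost B w c f g ξ t + V (energy B f ξ (t + 1)) =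
      stepCost B w c f g ζ t + V (energy B f ζ (t + 1)) := by
  rw [stepCost_congr h, energy_congr fun s hs => h s (Nat.lt_succ_iff.1 hs)]

/-- The dynamic programming inequality for an arbitrary strategy profile. -/
theorem IsModel.valueFn_succ_le (hm : IsModel P X Z π pZ) (hπ : ∀ i, SymmUnimodal (π i) (a i))
    (hw : ∀ i, 0 < w i) (hf : f.Admissible) {g : (i : Fin N) → Estimator (n i)}
    (hg : ∀ i, (g i).Admissible) (k t : ℕ) :
    ∫⁻ ω, valueFn π pZ a B w c (k + 1) (energy B f (fun s => (X s ω, Z s ω)) t) ∂P ≤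
      ∫⁻ ω, stepCost B w c f g (fun s => (X s ω, Z s ω)) t +
        valueFn π pZ a B w c k (energy B f (fun s => (X s ω, Z s ω)) (t + 1)) ∂P := by
  rw [hm.lintegral_eq (measurable_step hf hg _ t) t fun ξ ζ h => step_congr _ h]
  refine lintegral_mono fun ω => ?_
  set ξ : ℕ → Obs n × ℕ := fun s => (X s ω, Z s ω)
  set V := valueFn π pZ a B w c k
  set b := defaultEstimate B f g ξ t
  -- For a fixed past, the default estimates `b` and the energy are constants while `x` is averaged,
  -- so moving the centers from `a` to `b` can only raise the mean of `bestCost`.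
  calc valueFn π pZ a B w c (k + 1) (energy B f ξ t)
      ≤ ∫⁻ x, bestCost w c (harvestMean B pZ V) (energy B f ξ t) (deviation b x) ∂(obsLaw π) :=
        lintegral_deviation_le hm.isPDF hπ (bestCost_mono hw c _ _) (measurable_bestCost w c _ _) b
    _ ≤ _ := lintegral_mono fun x => ?_
  set u := dec B f (Function.update ξ t (x, 0)) t with hu
  have hfeas : energy B f ξ t = 0 → u = none := fun h => dec_eq_none hf (by
    rw [← h]
    exact energy_congr fun s hs => by simp [hs.ne])
  calc bestCost w c (harvestMean B pZ V) (energy B f ξ t) (deviation b x)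
      ≤ stageCost w c u (deviation b x) + harvestMean B pZ V (energy B f ξ t - spent u) :=
        iInf_le _ (⟨u, hfeas⟩ : {u : Decision N // energy B f ξ t = 0 → u = none})
    _ = ∫⁻ z, stageCost w c u (deviation b x) +
          V (energy B f (Function.update ξ t (x, z)) (t + 1)) ∂pZ.toMeasure := by
        rw [lintegral_add_left measurable_const, lintegral_energy_succ]
        simp [u]
    _ ≤ _ := lintegral_mono fun z => add_le_add ?_ le_rfl
  refine le_of_eq_of_le ?_ (stageCost_le_stepCost w c g)
  rw [defaultEstimate_congr (ζ := ξ) fun s hs => by simp [hs.ne], hu,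
    dec_congr (ζ := Function.update ξ t (x, z)) (fun s hs => by simp [hs.ne]) (by simp)]
  simp [b]

/-- The optimal threshold for sensor `i` at time `t` and energy level `e`, for the horizon `T`. -/
def optimalThreshold (π : (i : Fin N) → EuclideanSpace ℝ (Fin (n i)) → ℝ) (pZ : PMF ℕ) (a : Obs n)
    (B T : ℕ) (w c : Fin N → ℝ) (i : Fin N) (t e : ℕ) : ℝ :=
  threshold c (harvestMean B pZ (valueFn π pZ a B w c (T - (t + 1)))) i e

/-- The rule with the optimal thresholds attains the dynamic programming bound. -/
theorem IsModel.step_le_valueFn_succ (hm : IsModel P X Z π pZ) (hw : ∀ i, 0 < w i)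
    (hc : ∀ i, 0 ≤ c i) {T : ℕ} {f : Scheduler n} (hf : f.Admissible)
    (hfe : f = currentStateScheduler fun t x e =>
      weightedRule w a (fun i => optimalThreshold π pZ a B T w c i t e) x e)
    (hg : ∀ i, Estimator.Admissible (defaultEstimator (a i))) {k t : ℕ} (hk : T - (t + 1) = k) :
    ∫⁻ ω, stepCost B w c f (fun i => defaultEstimator (a i)) (fun s => (X s ω, Z s ω)) t +
        valueFn π pZ a B w c k (energy B f (fun s => (X s ω, Z s ω)) (t + 1)) ∂P ≤
      ∫⁻ ω, valueFn π pZ a B w c (k + 1) (energy B f (fun s => (X s ω, Z s ω)) t) ∂P := by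
  rw [hm.lintegral_eq (measurable_step hf hg _ t) t fun ξ ζ h => step_congr _ h]
  refine lintegral_mono fun ω => ?_
  set ξ : ℕ → Obs n × ℕ := fun s => (X s ω, Z s ω)
  set V := valueFn π pZ a B w c k with hV
  set e := energy B f ξ t with he
  set C := harvestMean B pZ V with hC
  have hCa : Antitone C := harvestMean_valueFn_antitone π pZ a B w c k
  have hdec : ∀ x z, dec B f (Function.update ξ t (x, z)) t =
      weightedRule w a (fun i => threshold c C i e) x e := fun x z => by
    have h1 : energy B f (Function.update ξ t (x, z)) t = e :=
      energy_congr fun s hs => by simp [hs.ne]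
    rw [← h1, hC, hV, ← hk, dec_eq]
    nth_rw 1 [hfe]
    simp [currentStateScheduler, energy, optimalThreshold]
  have hinner : ∀ x, ∫⁻ z, stepCost B w c f (fun i => defaultEstimator (a i))
        (Function.update ξ t (x, z)) t +
        V (energy B f (Function.update ξ t (x, z)) (t + 1)) ∂pZ.toMeasure =
      stageCost w c (weightedRule w a (fun i => threshold c C i e) x e) (deviation a x) +
        C (e - spent (weightedRule w a (fun i => threshold c C i e) x e)) := fun x => by
    simp only [stepCost_defaultEstimator, hdec, Function.update_self]
    rw [lintegral_add_left measurable_const, lintegral_energy_succ, hdec]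
    simp [hC, he]
  simp only [hinner]
  change _ ≤ ∫⁻ x, bestCost w c C e (deviation a x) ∂(obsLaw π)
  rcases Nat.eq_zero_or_pos e with h0 | hpos
  · refine lintegral_mono fun x => le_iInf fun u => ?_
    rw [u.2 h0]
    simp only [h0, weightedRule_zero, le_refl]
  -- If `C (e - 1)` is infinite, transmitting costs infinity pointwise, and by `valueFn_le` silence
  -- has infinite mean stage cost. The right-hand side is then infinite, so any threshold will do,
  -- including the default in `threshold`.
  by_cases hfin : C (e - 1) = ∞
  · refine le_top.trans (top_le_iff.2 ?_).ge
    have : IsProbabilityMeasure (obsLaw π) := isProbabilityMeasure_obsLaw hm.isPDF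
    have hS : ∫⁻ x, stageCost w c none (deviation a x) ∂(obsLaw π) = ∞ := by
      by_contra hS
      refine ENNReal.mul_ne_top (ENNReal.natCast_ne_top k) hS (top_le_iff.1 (hfin ▸ ?_))
      exact (lintegral_mono fun z => valueFn_le pZ a B w c hm.isPDF k _).trans (by simp)
    rw [eq_top_iff, ← hS]
    refine lintegral_mono fun x => le_iInf fun u => ?_
    rcases u with ⟨_ | i, hu⟩
    · exact le_self_add
    · simp [spent, hfin]
  · exact lintegral_mono fun x => stageCost_weightedRule_le hw hc hCa a x hpos.ne' hfin

/-! ### Admissibility of the rules and global optimality -/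

theorem measurable_find? {α : Type*} [MeasurableSpace α] {p : α → Fin N → Bool}
    (hp : ∀ i, MeasurableSet {x | p x i = true}) : Measurable fun x => Fin.find? (p x) := by
  have hp' : ∀ i, MeasurableSet {x | p x i = false} := fun i => by
    simpa [Set.compl_def] using (hp i).compl
  refine measurable_to_countable' fun u => ?_
  cases u with
  | none =>
    have : (fun x => Fin.find? (p x)) ⁻¹' {none} = ⋂ i, {x | p x i = false} := by
      ext x
      simp
    rw [this]
    exact MeasurableSet.iInter hp'
  | some i =>
    have : (fun x => Fin.find? (p x)) ⁻¹' {some i} =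
        {x | p x i = true} ∩ ⋂ j, ⋂ (_ : j < i), {x | p x j = false} := by
      ext x
      simp
    rw [this]
    exact (hp i).inter (MeasurableSet.iInter fun j => MeasurableSet.iInter fun _ => hp' j)

theorem measurable_weightedRule (w : Fin N → ℝ) (a : Obs n) (θ : Fin N → ℝ) (e : ℕ) :
    Measurable fun x : Obs n => weightedRule w a θ x e := by
  classical
  have hd : ∀ i, Measurable fun x : Obs n => ‖x i - a i‖ := fun i =>
    ((measurable_pi_apply i).sub_const _).norm
  unfold weightedRule
  refine Measurable.ite ?_ measurable_const (measurable_find? fun i => ?_)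
  · exact (MeasurableSet.const _).union (measurableSet_setOfPred.2 (Measurable.forall fun i =>
      measurableSet_setOfPred.1 (measurableSet_le (hd i) measurable_const)))
  · simp only [decide_eq_true_eq]
    exact (measurableSet_lt measurable_const (hd i)).inter (measurableSet_setOfPred.2
      (Measurable.forall fun j => measurableSet_setOfPred.1 (measurableSet_le measurable_const
        ((((hd i).pow_const 2).const_mul (w i)).sub (((hd j).pow_const 2).const_mul (w j))))))

theorem admissible_weightedRule (w : Fin N → ℝ) (a : Obs n) (τ : Fin N → ℕ → ℕ → ℝ) :
    Scheduler.Admissible (currentStateScheduler fun t x e =>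
      weightedRule w a (fun i => τ i t e) x e) where
  measurable t := by
    have h : Measurable fun p : Obs n × ℕ => weightedRule w a (fun i => τ i t p.2) p.1 p.2 :=
      measurable_from_prod_countable_left fun e => measurable_weightedRule w a (fun i => τ i t e) e
    have hlast : Measurable fun q : (Fin (t + 1) → Obs n) × (Fin (t + 1) → ℕ) ×
        (Fin t → Packets n) => (q.1 (Fin.last t), q.2.1 (Fin.last t)) :=
      measurable_fst.eval.prodMk (measurable_fst.comp measurable_snd).eval
    exact h.comp hlast
  feasible t x e y h := by
    simp only [currentStateScheduler, h, weightedRule_zero]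

theorem admissible_defaultEstimator {d : ℕ} (a : EuclideanSpace ℝ (Fin d)) :
    (defaultEstimator a).Admissible := fun t =>
  (measurable_of_comp_some (f := fun y : Option (EuclideanSpace ℝ (Fin d)) => y.getD a)
    measurable_id).comp (measurable_pi_apply (Fin.last t))

/-- The weighted rule with the optimal thresholds and the default estimators are jointly optimal. -/
theorem IsModel.isGloballyOptimal (hm : IsModel P X Z π pZ)
    (hπ : ∀ i, SymmUnimodal (π i) (a i)) (B T : ℕ) (hw : ∀ i, 0 < w i) (hc : ∀ i, 0 ≤ c i) :
    IsGloballyOptimal P X Z B T w c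
      (currentStateScheduler fun t x e =>
        weightedRule w a (fun i => optimalThreshold π pZ a B T w c i t e) x e)
      (fun i => defaultEstimator (a i)) := by
  have hfs := admissible_weightedRule w a (optimalThreshold π pZ a B T w c)
  have hgs := fun i => admissible_defaultEstimator (a i)
  refine ⟨hfs, hgs, fun f' g' hf' hg' => ?_⟩
  have hrow : Measurable fun ω s => (X s ω, Z s ω) := measurable_pi_lambda _ fun s =>
    (hm.measurable_source s).prodMk (hm.measurable_harvest s)
  have split : ∀ {f : Scheduler n} {g : (i : Fin N) → Estimator (n i)}, f.Admissible →
      (∀ i, (g i).Admissible) → ∀ k t,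
      ∫⁻ ω, stepCost B w c f g (fun s => (X s ω, Z s ω)) t +
        valueFn π pZ a B w c k (energy B f (fun s => (X s ω, Z s ω)) (t + 1)) ∂P =
      ∫⁻ ω, stepCost B w c f g (fun s => (X s ω, Z s ω)) t ∂P +
        ∫⁻ ω, valueFn π pZ a B w c k (energy B f (fun s => (X s ω, Z s ω)) (t + 1)) ∂P :=
    fun hf hg k t => lintegral_add_left ((measurable_stepCost hf hg t).comp hrow) _
  -- Cost paid before time `m` plus the mean value of the remaining `T - m` steps never decreases in
  -- `m` for an arbitrary profile. In `hup` it never increases for the candidate; at `m = T` only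
  -- the cost remains.
  have hlow : ∀ m ≤ T, valueFn π pZ a B w c T B ≤
      ∑ t ∈ Finset.range m, ∫⁻ ω, stepCost B w c f' g' (fun s => (X s ω, Z s ω)) t ∂P +
        ∫⁻ ω, valueFn π pZ a B w c (T - m) (energy B f' (fun s => (X s ω, Z s ω)) m) ∂P := by
    intro m hmT
    induction m with
    | zero => simp [energy_zero]
    | succ m ih =>
      refine (ih (by omega)).trans ?_
      rw [Finset.sum_range_succ, add_assoc, ← split hf' hg',
        show T - m = T - (m + 1) + 1 by omega]
      exact add_le_add le_rfl (hm.valueFn_succ_le hπ hw hf' hg' _ m)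
  have hup : ∀ m ≤ T, ∑ t ∈ Finset.range m, ∫⁻ ω, stepCost B w c
        (currentStateScheduler fun t x e =>
          weightedRule w a (fun i => optimalThreshold π pZ a B T w c i t e) x e)
        (fun i => defaultEstimator (a i)) (fun s => (X s ω, Z s ω)) t ∂P +
        ∫⁻ ω, valueFn π pZ a B w c (T - m) (energy B (currentStateScheduler fun t x e =>
          weightedRule w a (fun i => optimalThreshold π pZ a B T w c i t e) x e)
          (fun s => (X s ω, Z s ω)) m) ∂P ≤ valueFn π pZ a B w c T B := by
    intro m hmT
    induction m with
    | zero => simp [energy_zero]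
    | succ m ih =>
      refine le_trans ?_ (ih (by omega))
      rw [Finset.sum_range_succ, add_assoc, ← split hfs hgs,
        show T - m = T - (m + 1) + 1 by omega]
      exact add_le_add le_rfl (hm.step_le_valueFn_succ hw hc hfs rfl hgs rfl)
  have h1 := hlow T le_rfl
  have h2 := hup T le_rfl
  simp only [Nat.sub_self, valueFn, lintegral_zero, add_zero] at h1 h2
  exact h2.trans h1

end optimality

end RemoteScheduling

end

open RemoteScheduling
theorem mainTheorem2 {N : ℕ} (hN : 2 ≤ N) (n : Fin N → ℕ)
    {Ω : Type*} [MeasurableSpace Ω] (P : Measure Ω) [IsProbabilityMeasure P]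
    (X : ℕ → Ω → Obs n) (Z : ℕ → Ω → ℕ)
    (π : (i : Fin N) → EuclideanSpace ℝ (Fin (n i)) → ℝ) (pZ : PMF ℕ)
    (hmodel : IsModel P X Z π pZ)
    (a : Obs n) (hπ : ∀ i, SymmUnimodal (π i) (a i))
    (B T : ℕ) :
    (∀ c : ℝ, 0 ≤ c →
      ∃ τ : ℕ → ℕ → ℝ, (∀ t e, 0 ≤ τ t e) ∧
        IsGloballyOptimal P X Z B T (fun _ => 1) (fun _ => c)
          (currentStateScheduler fun t x e => maxDeviationRule a (τ t e) x e)
          (fun i => defaultEstimator (a i))) ∧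
    (∀ w c : Fin N → ℝ, (∀ i, 0 < w i) → (∀ i, 0 ≤ c i) →
      ∃ τ : Fin N → ℕ → ℕ → ℝ, (∀ i t e, 0 ≤ τ i t e) ∧
        IsGloballyOptimal P X Z B T w c
          (currentStateScheduler fun t x e => weightedRule w a (fun i => τ i t e) x e)
          (fun i => defaultEstimator (a i))) := by
  refine ⟨fun c hc => ?_, fun w c hw hc => ?_⟩
  -- With equal costs the thresholds do not depend on the sensor, so any index serves. The square
  -- root converts a threshold on squared deviations into one on deviations.
  · let i₀ : Fin N := ⟨0, by omega⟩
    refine ⟨fun t e => √(optimalThreshold π pZ a B T (fun _ => 1) (fun _ => c) i₀ t e),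
      fun t e => Real.sqrt_nonneg _, ?_⟩
    simp only [maxDeviationRule_sqrt]
    exact hmodel.isGloballyOptimal hπ B T (fun _ => one_pos) (fun _ => hc)
  · exact ⟨optimalThreshold π pZ a B T w c,
      fun i t e => threshold_nonneg hc (harvestMean_valueFn_antitone π pZ a B w c _) i e,
      hmodel.isGloballyOptimal hπ B T hw hc⟩
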